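/- Let $a,b,c,d,e\in\mathbb{R}$ with $ac\neq 0$, let $A(z)=az+b$ and $B(z)=cz^2+dz+e$, and let $\Delta(z)=A(z)^2+4B(z)$ and $x_A=-b/a$. Let $W_0,W_1,W_2,\dots\in\mathbb{C}[z]$ be polynomials with $$W_n(z)=A(z)W_{n-1}(z)+B(z)W_{n-2}(z)\qquad(n\ge 2),$$ and suppose that the sequence is general, i.e. (i) the polynomial $W_1^2-AW_0W_1-BW_0^2$ is not identically zero, (ii) $A$ and $B$ have no common complex zero, and (iii) $W_0$ and $W_1$ have no common complex zero. Call a polynomial real-rooted (resp. Hurwitz, Schur stable) if all its complex zeros lie on the real axis (resp. in the closed left half-plane $\{\operatorname{Re} z\le 0\}$, in the closed unit disk $\{|z|\le 1\}$), and say that the $W_n$ eventually have such a property if there is $N>0$ such that $W_n$ has it for all $n>N$. Then: 1. If the $W_n$ are eventually real-rooted, then $\Delta(x_A)<0$, and $\Delta$ is either a negative constant or real-rooted. 2. If the $W_n$ are eventually Hurwitz, then $\Delta$ has a positive leading coefficient, and $A\Delta$ is Hurwitz. 3. If the $W_n$ are eventually Schur stable, then $\Delta$ is quadratic with a positive leading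 coefficient, and $A\Delta$ is Schur stable. -/

import Mathlib

open Polynomial

noncomputable section

/-- All complex zeros of `p` lie on the real axis. -/
def IsRealRooted {R : Type*} [CommSemiring R] [Algebra R ℂ] (p : R[X]) : Prop :=
  ∀ z : ℂ, aeval z p = 0 → z.im = 0

/-- All complex zeros of `p` lie in the closed left half-plane. -/
def IsHurwitz {R : Type*} [CommSemiring R] [Algebra R ℂ] (p : R[X]) : Prop :=
  ∀ z : ℂ, aeval z p = 0 → z.re ≤ 0

/-- All complex zeros of `p` lie in the closed unit disk. -/
def IsSchurStable {R : Type*} [CommSemiring R] [Algebra R ℂ] (p : R[X]) : Prop :=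
  ∀ z : ℂ, aeval z p = 0 → ‖z‖ ≤ 1

/-- The property `P` holds for all members of the sequence from some point on. -/
def EventuallyHas (P : ℂ[X] → Prop) (W : ℕ → ℂ[X]) : Prop :=
  ∃ N : ℕ, 0 < N ∧ ∀ n : ℕ, N < n → P (W n)

/-- The linear coefficient `A(z) = a z + b`. -/
def coeffA (a b : ℝ) : ℝ[X] := C a * X + C b

/-- The quadratic coefficient `B(z) = c z ^ 2 + d z + e`. -/
def coeffB (c d e : ℝ) : ℝ[X] := C c * X ^ 2 + C d * X + C e

/-- The discriminant polynomial `Δ = A ^ 2 + 4 B` of the recurrence. -/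
def discrPoly (a b c d e : ℝ) : ℝ[X] := coeffA a b ^ 2 + 4 * coeffB c d e

/-- The zero `x_A = -b / a` of `A` (used for `a ≠ 0`). -/
def zeroA (a b : ℝ) : ℝ := -b / a

/-- A real polynomial regarded as a complex one. -/
def toComplexPoly (p : ℝ[X]) : ℂ[X] := p.map (algebraMap ℝ ℂ)

/-- `W` satisfies `W n = A * W (n - 1) + B * W (n - 2)` for all `n ≥ 2`. -/
def SatisfiesRec (a b c d e : ℝ) (W : ℕ → ℂ[X]) : Prop :=
  ∀ n : ℕ, W (n + 2) =
    toComplexPoly (coeffA a b) * W (n + 1) + toComplexPoly (coeffB c d e) * W n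

/-- A general sequence: it satisfies the recurrence, the polynomial
`W₁² - A W₀ W₁ - B W₀²` is not identically zero, and neither `A, B` nor `W₀, W₁`
have a common complex zero. -/
structure IsGeneralSeq (a b c d e : ℝ) (W : ℕ → ℂ[X]) : Prop where
  recurrence : SatisfiesRec a b c d e W
  nondegenerate :
    W 1 ^ 2 - toComplexPoly (coeffA a b) * W 0 * W 1
      - toComplexPoly (coeffB c d e) * W 0 ^ 2 ≠ 0
  coeff_no_common_zero :
    ¬ ∃ z : ℂ, aeval z (coeffA a b) = 0 ∧ aeval z (coeffB c d e) = 0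
  init_no_common_zero :
    ¬ ∃ z : ℂ, aeval z (W 0) = 0 ∧ aeval z (W 1) = 0

end

/-! With `s ^ 2 = Δ` and characteristic roots `l, m = (A ± s) / 2`, the closed form is `s * W n = p
* l ^ n - q * m ^ n`, where `p * q` is the nondegeneracy polynomial. Off the zeros of `s`, `l` and
`q`, the zeros of `W n` solve `(m / l) ^ n = p / q`. Where `|l| = |m|`, that is `A ^ 2 = -t * Δ`
with `t ≥ 0`, a nonconstant analytic `m / l` covers an arc of the unit circle, so its high powers
attain nearby values of `p / q`: zeros of `W n` accumulate there (`eventually_exists_zero_near`).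
Exceptional points of this locus, among them the zeros of `A` and `Δ`, are limits of generic ones.
Hence a closed set holding all late zeros contains the whole locus (`IsGeneralSeq.mem_of_isClosed`).
The three claims follow by exhibiting points of the locus outside the real line, half-plane or disk.
-/

open Filter Topology Metric

/-! ### Analytic logarithms and the equation `r ^ n = h` -/

/-- A nonvanishing analytic function has a local analytic logarithm. -/
theorem AnalyticAt.exists_log {f : ℂ → ℂ} {z₀ : ℂ} (hf : AnalyticAt ℂ f z₀) (h0 : f z₀ ≠ 0) :
    ∃ g : ℂ → ℂ, AnalyticAt ℂ g z₀ ∧ ∀ᶠ z in 𝓝 z₀, Complex.exp (g z) = f z := by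
  refine ⟨fun z => Complex.log (f z / f z₀) + Complex.log (f z₀), ?_, ?_⟩
  · refine AnalyticAt.add (AnalyticAt.clog (hf.div analyticAt_const h0) ?_) analyticAt_const
    simp [div_self h0]
  · filter_upwards [hf.continuousAt.eventually_ne h0] with z hz
    rw [Complex.exp_add, Complex.exp_log (div_ne_zero hz h0), Complex.exp_log h0,
      div_mul_cancel₀ _ h0]

/-- A nonvanishing analytic function has a local analytic square root. -/
theorem AnalyticAt.exists_sq_eq {f : ℂ → ℂ} {z₀ : ℂ} (hf : AnalyticAt ℂ f z₀) (h0 : f z₀ ≠ 0) :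
    ∃ s : ℂ → ℂ, AnalyticAt ℂ s z₀ ∧ ∀ᶠ z in 𝓝 z₀, s z ^ 2 = f z := by
  obtain ⟨g, hg, hgf⟩ := hf.exists_log h0
  refine ⟨fun z => Complex.exp (g z / 2), (hg.div analyticAt_const two_ne_zero).cexp, ?_⟩
  filter_upwards [hgf] with z hz
  rw [← hz, ← Complex.exp_nat_mul]
  congr 1
  push_cast
  ring

/-- Near a point where a nonconstant analytic `r` has modulus one, the equation `r ^ n = h` is
solvable for all large `n`. -/
theorem eventually_exists_pow_eq {r h : ℂ → ℂ} {z₀ : ℂ} (hr : AnalyticAt ℂ r z₀)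
    (hh : AnalyticAt ℂ h z₀) (hr1 : ‖r z₀‖ = 1) (hh0 : h z₀ ≠ 0)
    (hrc : ¬ ∀ᶠ z in 𝓝 z₀, r z = r z₀) {U : Set ℂ} (hU : U ∈ 𝓝 z₀) :
    ∀ᶠ n : ℕ in atTop, ∃ z ∈ U, r z ^ n = h z := by
  have hr0 : r z₀ ≠ 0 := by
    intro h0
    simp [h0] at hr1
  obtain ⟨θ, hθ, hθr⟩ := hr.exists_log hr0
  obtain ⟨η, hη, hηh⟩ := hh.exists_log hh0
  have hθre : (θ z₀).re = 0 := by
    have := hθr.self_of_nhds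
    rw [← this, Complex.norm_exp] at hr1
    exact Real.exp_eq_one_iff _ |>.1 hr1
  have hθne : ∀ᶠ z in 𝓝[≠] z₀, θ z ≠ θ z₀ := by
    refine (hθ.eventually_eq_or_eventually_ne analyticAt_const).resolve_left fun hc => hrc ?_
    filter_upwards [hc, hθr] with z hz hz'
    rw [← hz', hz, hθr.self_of_nhds]
  rw [eventually_nhdsWithin_iff] at hθne
  obtain ⟨ρ, hρ, hball⟩ := (nhds_basis_closedBall (x := z₀)).eventually_iff.1
    (hθne.and <| hθr.and <| hηh.and <| (eventually_mem_set.2 hU).and <|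
      hθ.eventually_analyticAt.and hη.eventually_analyticAt)
  have hθA : AnalyticOnNhd ℂ θ (closedBall z₀ ρ) := fun z hz => (hball hz).2.2.2.2.1
  have hηA : AnalyticOnNhd ℂ η (closedBall z₀ ρ) := fun z hz => (hball hz).2.2.2.2.2
  obtain ⟨M, hM⟩ := (isCompact_closedBall z₀ ρ).exists_bound_of_continuousOn hηA.continuousOn
  have hz₀ : z₀ ∈ closedBall z₀ ρ := mem_closedBall_self hρ.le
  have hM0 : 0 ≤ M := (norm_nonneg _).trans (hM z₀ hz₀)
  obtain ⟨w, hw, hwmin⟩ := (isCompact_sphere z₀ ρ).exists_isMinOn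
    (NormedSpace.sphere_nonempty.2 hρ.le) (f := fun z => ‖θ z - θ z₀‖)
    ((hθA.continuousOn.mono sphere_subset_closedBall).sub continuousOn_const).norm
  set ε := ‖θ w - θ z₀‖ with hε
  have hε0 : 0 < ε := norm_pos_iff.2 <| sub_ne_zero.2 <|
    (hball (sphere_subset_closedBall hw)).1 (ne_of_mem_sphere hw hρ.ne')
  -- The target value below lies within `(π + M) / n` of `f z₀`, while the quantitative open mapping
  -- theorem yields a disk of radius `ε / 4`.
  filter_upwards [(tendsto_natCast_atTop_atTop (R := ℝ)).eventually_gt_atTop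
    (4 * (Real.pi + M) / ε), eventually_gt_atTop 0] with n hn hn0
  have hnR : (0 : ℝ) < n := by exact_mod_cast hn0
  have hnC : (n : ℂ) ≠ 0 := by exact_mod_cast hn0.ne'
  have hsmall : (Real.pi + M) / n < ε / 4 := by
    rw [div_lt_iff₀ hε0] at hn
    rw [div_lt_iff₀ hnR]
    linarith
  have hMn : M / n ≤ ε / 4 := by
    refine le_trans ?_ hsmall.le
    gcongr
    linarith [Real.pi_pos]
  -- `r ^ n = h` holds as soon as `n * θ - η` is a multiple of `2πi`, that is, `f` takes a value
  -- `2πik / n`.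
  set f : ℂ → ℂ := fun z => θ z - η z / n with hf
  have hfA : AnalyticOnNhd ℂ f (closedBall z₀ ρ) := fun z hz =>
    (hθA z hz).sub ((hηA z hz).div analyticAt_const hnC)
  have hηn : ∀ z ∈ closedBall z₀ ρ, ‖η z / n‖ ≤ M / n := fun z hz => by
    rw [norm_div, Complex.norm_natCast]
    gcongr
    exact hM z hz
  have hfs : ∀ z ∈ sphere z₀ ρ, ε / 2 ≤ ‖f z - f z₀‖ := by
    intro z hz
    have h1 : ε ≤ ‖θ z - θ z₀‖ := hwmin hz
    have h2 := hηn z (sphere_subset_closedBall hz)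
    have h3 := hηn z₀ hz₀
    have h4 : θ z - θ z₀ = (f z - f z₀) + (η z / n - η z₀ / n) := by simp only [hf]; ring
    have h5 := norm_add_le (f z - f z₀) (η z / n - η z₀ / n)
    have h6 := norm_sub_le (η z / n) (η z₀ / n)
    rw [← h4] at h5
    linarith
  have hfc : ∃ᶠ z in 𝓝 z₀, f z ≠ f z₀ := by
    intro hc
    have hc' : f =ᶠ[𝓝 z₀] fun _ => f z₀ := by
      filter_upwards [hc] with z hz using not_not.1 hz
    have h1 := hfA.eqOn_of_preconnected_of_eventuallyEq analyticOnNhd_const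
      (convex_closedBall z₀ ρ).isPreconnected hz₀ hc' (sphere_subset_closedBall hw)
    have h2 := hfs w hw
    rw [h1, sub_self, norm_zero] at h2
    linarith
  have hdiff : DiffContOnCl ℂ f (ball z₀ ρ) :=
    DifferentiableOn.diffContOnCl (hfA.differentiableOn.mono closure_ball_subset_closedBall)
  have hsub := hdiff.ball_subset_image_closedBall hρ hfs hfc
  -- Since `θ z₀` is purely imaginary, rounding gives a multiple of `2πi / n` within `π / n` of it.
  set k : ℤ := round (n * (θ z₀).im / (2 * Real.pi)) with hk
  have hkclose : |(θ z₀).im - 2 * Real.pi * k / n| ≤ Real.pi / n := by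
    have h1 := abs_sub_round ((n : ℝ) * (θ z₀).im / (2 * Real.pi))
    rw [← hk] at h1
    have h2 : (θ z₀).im - 2 * Real.pi * k / n
        = (2 * Real.pi / n) * (n * (θ z₀).im / (2 * Real.pi) - k) := by
      field_simp
    rw [h2, abs_mul, abs_of_pos (by positivity)]
    calc _ ≤ 2 * Real.pi / n * (1 / 2) := by gcongr
      _ = _ := by ring
  obtain ⟨z, hz, hfz⟩ : (2 * Real.pi * k / n * Complex.I : ℂ) ∈ f '' closedBall z₀ ρ := by
    apply hsub
    rw [mem_ball, dist_comm, dist_eq_norm]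
    have h1 : f z₀ - 2 * Real.pi * k / n * Complex.I
        = (((θ z₀).im - 2 * Real.pi * k / n : ℝ) : ℂ) * Complex.I - η z₀ / n := by
      have : θ z₀ = (θ z₀).im * Complex.I := by
        apply Complex.ext <;> simp [hθre]
      simp only [hf]
      rw [this]
      push_cast
      simp
      ring
    rw [h1]
    have h2 := norm_sub_le ((((θ z₀).im - 2 * Real.pi * k / n : ℝ) : ℂ) * Complex.I) (η z₀ / n)
    rw [norm_mul, Complex.norm_I, mul_one, Complex.norm_real, Real.norm_eq_abs] at h2
    have h3 := hηn z₀ hz₀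
    rw [add_div] at hsmall
    linarith
  obtain ⟨-, h2, h3, h4, -⟩ := hball hz
  refine ⟨z, h4, ?_⟩
  rw [← h2, ← h3, ← Complex.exp_nat_mul, Complex.exp_eq_exp_iff_exists_int]
  refine ⟨k, ?_⟩
  have h5 : θ z = 2 * Real.pi * k / n * Complex.I + η z / n := by rw [← hfz]; simp [hf]
  rw [h5]
  field_simp
  ring

/-! ### Closed form and accumulation of zeros -/

/-- Closed form for a second-order linear recurrence, cleared of denominators. -/
theorem sqrt_discr_mul_eq_of_rec {α β s : ℂ} {w : ℕ → ℂ} (hs : s ^ 2 = α ^ 2 + 4 * β)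
    (hw : ∀ n, w (n + 2) = α * w (n + 1) + β * w n) (n : ℕ) :
    s * w n = (w 1 - (α - s) / 2 * w 0) * ((α + s) / 2) ^ n
      - (w 1 - (α + s) / 2 * w 0) * ((α - s) / 2) ^ n := by
  have hβ : β = (s ^ 2 - α ^ 2) / 4 := by rw [hs]; ring
  induction n using Nat.twoStepInduction with
  | zero => ring
  | one => ring
  | more n ih1 ih2 =>
    rw [hw, mul_add, mul_left_comm, ih2, mul_left_comm, ih1, hβ]
    ring

/-- The two characteristic roots `(u ± s) / 2` have equal modulus when `u ^ 2 / s ^ 2 ≤ 0`. -/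
theorem norm_sub_eq_norm_add_of_sq_eq {u s : ℂ} {t : ℝ} (ht : 0 ≤ t) (h : u ^ 2 = -t * s ^ 2) :
    ‖u - s‖ = ‖u + s‖ := by
  -- Thus `u = ± i√t * s`, and an imaginary number is equidistant from `1` and `-1`.
  have h1 : (u - Real.sqrt t * Complex.I * s) * (u + Real.sqrt t * Complex.I * s) = 0 := by
    have h2 : ((Real.sqrt t : ℝ) : ℂ) ^ 2 = t := by
      rw [← Complex.ofReal_pow, Real.sq_sqrt ht]
    linear_combination h + s ^ 2 * h2 - (Real.sqrt t : ℂ) ^ 2 * s ^ 2 * Complex.I_sq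
  have key : ∀ y : ℝ, ‖(y * Complex.I : ℂ) - 1‖ = ‖(y * Complex.I : ℂ) + 1‖ := fun y => by
    rw [Complex.norm_def, Complex.norm_def]
    simp [Complex.normSq_apply]
  have key' : ∀ y : ℝ, u = y * Complex.I * s → ‖u - s‖ = ‖u + s‖ := fun y hy => by
    have h2 : u - s = (y * Complex.I - 1) * s := by rw [hy]; ring
    have h3 : u + s = (y * Complex.I + 1) * s := by rw [hy]; ring
    rw [h2, h3, norm_mul, norm_mul, key]
  rcases mul_eq_zero.1 h1 with h2 | h2
  · exact key' (Real.sqrt t) (sub_eq_zero.1 h2)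
  · refine key' (-Real.sqrt t) ?_
    push_cast
    linear_combination h2

/-- At a point where the characteristic roots have equal modulus (and which is otherwise generic)
zeros of the `W n` accumulate. -/
theorem eventually_exists_zero_near {A B : ℂ[X]} {W : ℕ → ℂ[X]}
    (hrec : ∀ n, W (n + 2) = A * W (n + 1) + B * W n) {z₀ : ℂ} {t : ℝ} (ht : 0 < t)
    (hA : A.eval z₀ ^ 2 = -t * (A ^ 2 + 4 * B).eval z₀)
    (hD0 : (A ^ 2 + 4 * B).eval z₀ ≠ 0)
    (hG : (W 1 ^ 2 - A * W 0 * W 1 - B * W 0 ^ 2).eval z₀ ≠ 0)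
    (hnc : ¬ ∀ᶠ z in 𝓝 z₀,
      (A ^ 2 + 4 * B).eval z * A.eval z₀ ^ 2 = (A ^ 2 + 4 * B).eval z₀ * A.eval z ^ 2)
    {U : Set ℂ} (hU : U ∈ 𝓝 z₀) :
    ∀ᶠ n : ℕ in atTop, ∃ z ∈ U, (W n).eval z = 0 := by
  have han : ∀ p : ℂ[X], AnalyticAt ℂ (fun z => p.eval z) z₀ := fun p =>
    p.differentiable.analyticAt z₀
  obtain ⟨s, hs, hsD⟩ := (han (A ^ 2 + 4 * B)).exists_sq_eq hD0
  have hs0 : s z₀ ^ 2 = (A ^ 2 + 4 * B).eval z₀ := hsD.self_of_nhds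
  have hs0' : s z₀ ≠ 0 := fun h => hD0 (by rw [← hs0, h]; ring)
  rw [← hs0] at hA
  have hB0 : s z₀ ^ 2 = A.eval z₀ ^ 2 + 4 * B.eval z₀ := by rw [hs0]; simp
  set l : ℂ → ℂ := fun z => (A.eval z + s z) / 2 with hl
  set m : ℂ → ℂ := fun z => (A.eval z - s z) / 2 with hm
  set p : ℂ → ℂ := fun z => (W 1).eval z - m z * (W 0).eval z with hp
  set q : ℂ → ℂ := fun z => (W 1).eval z - l z * (W 0).eval z with hq
  have hlA : AnalyticAt ℂ l z₀ := ((han A).add hs).div analyticAt_const two_ne_zero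
  have hmA : AnalyticAt ℂ m z₀ := ((han A).sub hs).div analyticAt_const two_ne_zero
  have hpA : AnalyticAt ℂ p z₀ := (han _).sub (hmA.mul (han _))
  have hqA : AnalyticAt ℂ q z₀ := (han _).sub (hlA.mul (han _))
  have hl0 : l z₀ ≠ 0 := by
    intro h
    have h1 : A.eval z₀ = - s z₀ := by
      simp only [hl] at h
      linear_combination 2 * h
    rw [h1] at hA
    have h2 : ((1 + t : ℝ) : ℂ) * s z₀ ^ 2 = 0 := by
      push_cast
      linear_combination hA
    rcases mul_eq_zero.1 h2 with h3 | h3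
    · rw [Complex.ofReal_eq_zero] at h3
      linarith
    · exact hs0' (by simpa using h3)
  have hpq : p z₀ * q z₀ = (W 1 ^ 2 - A * W 0 * W 1 - B * W 0 ^ 2).eval z₀ := by
    simp only [hp, hq, hl, hm, eval_sub, eval_mul, eval_pow]
    linear_combination (- (W 0).eval z₀ ^ 2 / 4) * hB0
  have hp0 : p z₀ ≠ 0 := fun h => hG (by rw [← hpq, h, zero_mul])
  have hq0 : q z₀ ≠ 0 := fun h => hG (by rw [← hpq, h, mul_zero])
  have hnorm : ‖m z₀ / l z₀‖ = 1 := by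
    rw [norm_div, div_eq_one_iff_eq (norm_ne_zero_iff.2 hl0)]
    simp only [hl, hm, norm_div]
    rw [norm_sub_eq_norm_add_of_sq_eq ht.le hA]
  -- A constant `m / l` makes `A / s` constant; squaring contradicts `hnc`.
  have hrc : ¬ ∀ᶠ z in 𝓝 z₀, m z / l z = m z₀ / l z₀ := by
    intro hc
    apply hnc
    filter_upwards [hc, hsD, hlA.continuousAt.eventually_ne hl0] with z hz hz' hlz
    rw [div_eq_div_iff hlz hl0] at hz
    rw [← hz', ← hs0]
    have h1 : A.eval z * s z₀ = s z * A.eval z₀ := by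
      simp only [hl, hm] at hz
      linear_combination 2 * hz
    linear_combination (- A.eval z * s z₀ - s z * A.eval z₀) * h1
  have hU' := (eventually_mem_set.2 hU).and <| hsD.and <|
    (hlA.continuousAt.eventually_ne hl0).and <| (hqA.continuousAt.eventually_ne hq0).and <|
    hs.continuousAt.eventually_ne hs0'
  filter_upwards [eventually_exists_pow_eq (hmA.div hlA hl0) (hpA.div hqA hq0) hnorm
    (div_ne_zero hp0 hq0) hrc hU'] with n hn
  obtain ⟨z, ⟨hzU, hsz, hlz, hqz, hs0z⟩, hz⟩ := hn
  refine ⟨z, hzU, ?_⟩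
  have hz2 : (m z / l z) ^ n = p z / q z := hz
  rw [div_pow, div_eq_div_iff (pow_ne_zero n hlz) hqz] at hz2
  have hcl := sqrt_discr_mul_eq_of_rec (α := A.eval z) (β := B.eval z) (s := s z)
    (w := fun n => (W n).eval z) (by rw [hsz]; simp) (fun n => by simp [hrec]) n
  have h0 : s z * (W n).eval z = 0 := by
    rw [hcl]
    simp only [hp, hq, hl, hm] at hz2
    linear_combination -hz2
  exact (mul_eq_zero.1 h0).resolve_left hs0z

/-- If `P / Q` is nonconstant with value `-t₀` at `z₀`, then it takes real values
`-t < -t₀` at points near `z₀`, off the zeros of any given nonzero polynomial. -/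
theorem exists_near_eval_eq_neg_mul {P Q H : ℂ[X]} {z₀ : ℂ} {t₀ : ℝ} (hQ : Q.eval z₀ ≠ 0)
    (h0 : P.eval z₀ = -t₀ * Q.eval z₀) (hPQ : P ≠ C (-t₀ : ℂ) * Q) (hH : H ≠ 0)
    {U : Set ℂ} (hU : U ∈ 𝓝 z₀) :
    ∃ z ∈ U, ∃ t : ℝ, t₀ < t ∧ P.eval z = -t * Q.eval z ∧ H.eval z ≠ 0 := by
  have han : ∀ p : ℂ[X], AnalyticAt ℂ (fun z => p.eval z) z₀ := fun p =>
    p.differentiable.analyticAt z₀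
  have hroot : ∀ p : ℂ[X], p ≠ 0 → ∀ᶠ z in 𝓝[≠] z₀, p.eval z ≠ 0 := fun p hp => by
    refine ((han p).eventually_eq_zero_or_eventually_ne_zero).resolve_left fun hc => hp ?_
    refine Polynomial.eq_zero_of_infinite_isRoot p (Set.Infinite.mono ?_ (infinite_of_mem_nhds z₀ hc))
    exact fun z hz => hz
  have hf0 : P.eval z₀ / Q.eval z₀ = -t₀ := by rw [h0, mul_div_cancel_right₀ _ hQ]
  have hQn := (han Q).continuousAt.eventually_ne hQ
  rcases ((han P).div (han Q) hQ).eventually_constant_or_nhds_le_map_nhds with hc | hc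
  · refine absurd ?_ hPQ
    rw [← sub_eq_zero]
    by_contra hne
    have h1 := hroot _ hne
    have h2 : ∀ᶠ z in 𝓝[≠] z₀, (P - C (-t₀ : ℂ) * Q).eval z = 0 := by
      filter_upwards [nhdsWithin_le_nhds hc, nhdsWithin_le_nhds hQn] with z hz hQz
      simp only [Pi.div_apply, hf0] at hz
      rw [div_eq_iff hQz] at hz
      simp [hz]
    obtain ⟨z, hz1, hz2⟩ := (h1.and h2).exists
    exact hz1 hz2
  · have hV : ∀ᶠ z in 𝓝 z₀, z ∈ U ∧ Q.eval z ≠ 0 ∧ (z ≠ z₀ → H.eval z ≠ 0) :=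
      (eventually_mem_set.2 hU).and (hQn.and (eventually_nhdsWithin_iff.1 (hroot H hH)))
    have him := hc (image_mem_map hV)
    simp only [Pi.div_apply, hf0] at him
    -- Approaching `t₀` strictly from above forces `z ≠ z₀`, so a zero of `H` at `z₀` does no harm.
    have hcont : Tendsto (fun t : ℝ => (-t : ℂ)) (𝓝[>] t₀) (𝓝 (-t₀ : ℂ)) :=
      ((Complex.continuous_ofReal.neg).tendsto t₀).mono_left nhdsWithin_le_nhds
    obtain ⟨t, ⟨z, ⟨hzU, hQz, hHz⟩, hzt⟩, ht⟩ :=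
      ((hcont.eventually_mem him).and (self_mem_nhdsWithin (s := Set.Ioi t₀))).exists
    have hzt' : P.eval z / Q.eval z = -t := hzt
    refine ⟨z, hzU, t, ht, (div_eq_iff hQz).1 hzt', hHz ?_⟩
    rintro rfl
    rw [hf0, neg_inj, Complex.ofReal_inj] at hzt'
    exact (ne_of_gt ht) hzt'.symm

/-! ### The equal-modulus locus of the recurrence -/

theorem aeval_coeffA (a b : ℝ) (z : ℂ) : aeval z (coeffA a b) = a * z + b := by
  simp [coeffA]

theorem aeval_coeffA_zeroA {a : ℝ} (b : ℝ) (ha : a ≠ 0) :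
    aeval (zeroA a b : ℂ) (coeffA a b) = 0 := by
  have : (a : ℂ) ≠ 0 := by exact_mod_cast ha
  rw [aeval_coeffA, zeroA]
  push_cast
  field_simp
  ring

theorem aeval_discrPoly (a b c d e : ℝ) (z : ℂ) :
    aeval z (discrPoly a b c d e) = aeval z (coeffA a b) ^ 2 + 4 * aeval z (coeffB c d e) := by
  simp only [discrPoly, map_add, map_mul, map_pow, map_ofNat]

theorem eval_toComplexPoly (p : ℝ[X]) (z : ℂ) : (toComplexPoly p).eval z = aeval z p := by
  simp [toComplexPoly, eval_map_algebraMap]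

theorem toComplexPoly_discrPoly (a b c d e : ℝ) : toComplexPoly (discrPoly a b c d e)
    = toComplexPoly (coeffA a b) ^ 2 + 4 * toComplexPoly (coeffB c d e) := by
  simp [toComplexPoly, discrPoly]

theorem aeval_ofReal_eq (p : ℝ[X]) (x : ℝ) : aeval (x : ℂ) p = ((p.eval x : ℝ) : ℂ) := by
  have := aeval_algebraMap_apply_eq_algebraMap_eval (A := ℂ) x p
  simpa using this

/-- At `x_A` one has `Δ = 4B`. This nonvanishing is what makes `A ^ 2 / Δ` nonconstant. -/
theorem IsGeneralSeq.aeval_discrPoly_zeroA_ne_zero {a b c d e : ℝ} {W : ℕ → ℂ[X]}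
    (hW : IsGeneralSeq a b c d e W) (ha : a ≠ 0) :
    aeval (zeroA a b : ℂ) (discrPoly a b c d e) ≠ 0 := by
  intro h
  rw [aeval_discrPoly, aeval_coeffA_zeroA b ha] at h
  exact hW.coeff_no_common_zero ⟨_, aeval_coeffA_zeroA b ha, by simpa using h⟩

theorem IsGeneralSeq.discrPoly_ne_zero {a b c d e : ℝ} {W : ℕ → ℂ[X]}
    (hW : IsGeneralSeq a b c d e W) (ha : a ≠ 0) : discrPoly a b c d e ≠ 0 := by
  intro h
  apply hW.aeval_discrPoly_zeroA_ne_zero ha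
  simp [h]

theorem toComplexPoly_ne_zero {p : ℝ[X]} (hp : p ≠ 0) : toComplexPoly p ≠ 0 :=
  (Polynomial.map_ne_zero_iff (algebraMap ℝ ℂ).injective).2 hp

theorem coeffA_ne_zero {a : ℝ} (b : ℝ) (ha : a ≠ 0) : coeffA a b ≠ 0 := by
  intro h
  apply ha
  have := congrArg (fun p => coeff p 1) h
  simpa [coeffA] using this

/-- A closed set that eventually contains the zeros of the `W n` contains every point at which the
two characteristic roots have equal modulus. -/
theorem IsGeneralSeq.mem_of_isClosed {a b c d e : ℝ} {W : ℕ → ℂ[X]}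
    (hW : IsGeneralSeq a b c d e W) (ha : a ≠ 0) {S : Set ℂ} (hS : IsClosed S)
    (hev : ∃ N : ℕ, 0 < N ∧ ∀ n, N < n → ∀ z : ℂ, aeval z (W n) = 0 → z ∈ S) {z₀ : ℂ}
    (hz₀ : aeval z₀ (discrPoly a b c d e) = 0 ∨
      ∃ t : ℝ, 0 ≤ t ∧ aeval z₀ (coeffA a b) ^ 2 = -t * aeval z₀ (discrPoly a b c d e)) :
    z₀ ∈ S := by
  by_contra hzS
  have hU : Sᶜ ∈ 𝓝 z₀ := hS.isOpen_compl.mem_nhds hzS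
  set A := toComplexPoly (coeffA a b) with hA
  set B := toComplexPoly (coeffB c d e) with hB
  set D := A ^ 2 + 4 * B with hD
  set G := W 1 ^ 2 - A * W 0 * W 1 - B * W 0 ^ 2 with hG
  have hDe : ∀ z, aeval z (discrPoly a b c d e) = D.eval z := fun z => by
    rw [hD, hA, hB, ← toComplexPoly_discrPoly, eval_toComplexPoly]
  have hAe : ∀ z, aeval z (coeffA a b) = A.eval z := fun z => (eval_toComplexPoly _ z).symm
  have hA0 : A ≠ 0 := toComplexPoly_ne_zero (coeffA_ne_zero b ha)
  have hD0 : D ≠ 0 := by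
    rw [hD, hA, hB, ← toComplexPoly_discrPoly]
    exact toComplexPoly_ne_zero (hW.discrPoly_ne_zero ha)
  have hxA : A.eval (zeroA a b : ℂ) = 0 := by rw [← hAe, aeval_coeffA_zeroA b ha]
  have hxD : D.eval (zeroA a b : ℂ) ≠ 0 := by
    rw [← hDe]
    exact hW.aeval_discrPoly_zeroA_ne_zero ha
  simp only [hDe, hAe] at hz₀
  obtain ⟨z₁, hz₁, t, ht, hAD, hH⟩ : ∃ z ∈ Sᶜ, ∃ t : ℝ, 0 < t ∧
      A.eval z ^ 2 = -t * D.eval z ∧ (A * D * G).eval z ≠ 0 := by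
    have hH0 : A * D * G ≠ 0 := mul_ne_zero (mul_ne_zero hA0 hD0) hW.nondegenerate
    by_cases hDz : D.eval z₀ = 0
    -- Here `A ^ 2 / Δ` has a pole, so the perturbation is applied to `Δ / A ^ 2` at the value `0`,
    -- and `t` is inverted afterwards.
    · have hAz : (A ^ 2).eval z₀ ≠ 0 := by
        intro h
        rw [eval_pow, sq_eq_zero_iff] at h
        refine hW.coeff_no_common_zero ⟨z₀, by rw [hAe, h], ?_⟩
        have := aeval_discrPoly a b c d e z₀
        rw [hDe, hAe, h, hDz] at this
        simpa using this.symm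
      obtain ⟨z, hz, t, ht, h1, h2⟩ := exists_near_eval_eq_neg_mul (P := D) (t₀ := 0) hAz
        (by simp [hDz]) (by simpa using hD0) hH0 hU
      refine ⟨z, hz, t⁻¹, inv_pos.2 ht, ?_, h2⟩
      have htC : (t : ℂ) ≠ 0 := by exact_mod_cast ht.ne'
      rw [h1, eval_pow]
      push_cast
      field_simp
    · obtain ⟨t₀, ht₀, h0⟩ := hz₀.resolve_left hDz
      have hne : A ^ 2 ≠ C (-t₀ : ℂ) * D := by
        intro h
        have h1 := congrArg (eval (zeroA a b : ℂ)) h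
        rw [eval_pow, hxA, eval_mul, eval_C] at h1
        have h2 : (-t₀ : ℂ) = 0 := by simpa [hxD] using h1.symm
        rw [h2] at h
        exact hA0 (by simpa using h)
      obtain ⟨z, hz, t, ht, h1, h2⟩ := exists_near_eval_eq_neg_mul (P := A ^ 2) (t₀ := t₀) hDz
        (by rw [eval_pow, h0]) hne hH0 hU
      exact ⟨z, hz, t, ht₀.trans_lt ht, by rw [← eval_pow, h1], h2⟩
  simp only [eval_mul] at hH
  have hGz := right_ne_zero_of_mul hH
  have hDz := right_ne_zero_of_mul (left_ne_zero_of_mul hH)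
  have hAz := left_ne_zero_of_mul (left_ne_zero_of_mul hH)
  have hnc : ¬ ∀ᶠ z in 𝓝 z₁, D.eval z * A.eval z₁ ^ 2 = D.eval z₁ * A.eval z ^ 2 := by
    intro hc
    have h1 : D * C (A.eval z₁ ^ 2) - C (D.eval z₁) * A ^ 2 = 0 := by
      refine Polynomial.eq_zero_of_infinite_isRoot _
        (Set.Infinite.mono ?_ (infinite_of_mem_nhds z₁ hc))
      intro z hz
      have hz' : D.eval z * A.eval z₁ ^ 2 = D.eval z₁ * A.eval z ^ 2 := hz
      simp [IsRoot, hz']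
    have h2 := congrArg (eval (zeroA a b : ℂ)) h1
    simp [hxA, hxD, hAz] at h2
  obtain ⟨N, -, hN⟩ := hev
  obtain ⟨n, ⟨z, hzU, hz⟩, hn⟩ := ((eventually_exists_zero_near hW.recurrence ht hAD hDz hGz
    hnc (hS.isOpen_compl.mem_nhds hz₁)).and (eventually_gt_atTop N)).exists
  exact hzU (hN n hn z (by simpa [coe_aeval_eq_eval] using hz))

/-! ### Points of the locus determined by `Δ` -/

/-- A real polynomial with negative leading coefficient is negative far to the right. -/
theorem Polynomial.eventually_eval_neg_of_leadingCoeff_neg {p : ℝ[X]} (hp : p.leadingCoeff < 0) :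
    ∀ᶠ x in atTop, p.eval x < 0 := by
  rcases lt_or_ge 0 p.degree with h | h
  · exact (p.tendsto_atBot_of_leadingCoeff_nonpos h hp.le).eventually_lt_atBot 0
  · rw [eq_C_of_degree_le_zero h] at hp ⊢
    simp only [leadingCoeff_C] at hp
    exact Eventually.of_forall fun x => by simpa using hp

theorem natDegree_discrPoly_le (a b c d e : ℝ) : (discrPoly a b c d e).natDegree ≤ 2 := by
  have : discrPoly a b c d e
      = C (a ^ 2 + 4 * c) * X ^ 2 + C (2 * a * b + 4 * d) * X + C (b ^ 2 + 4 * e) := by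
    simp only [discrPoly, coeffA, coeffB, map_add, map_mul, map_pow]
    have : (C (4 : ℝ) : ℝ[X]) = 4 := rfl
    have : (C (2 : ℝ) : ℝ[X]) = 2 := rfl
    simp only [*]
    ring
  rw [this]
  exact natDegree_quadratic_le

/-- A real point with `Δ < 0` is a point of equal modulus. -/
theorem exists_sq_eq_neg_mul_of_discrPoly_neg {a b c d e x : ℝ}
    (hx : (discrPoly a b c d e).eval x < 0) :
    ∃ t : ℝ, 0 ≤ t ∧
      aeval (x : ℂ) (coeffA a b) ^ 2 = -t * aeval (x : ℂ) (discrPoly a b c d e) := by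
  refine ⟨(coeffA a b).eval x ^ 2 / -(discrPoly a b c d e).eval x,
    div_nonneg (sq_nonneg _) (by linarith), ?_⟩
  have h0 : (((discrPoly a b c d e).eval x : ℝ) : ℂ) ≠ 0 := by exact_mod_cast hx.ne
  rw [aeval_ofReal_eq, aeval_ofReal_eq]
  push_cast
  field_simp

/-- If `Δ` is positive at the zero of `A`, then some nonreal point has equal moduli. -/
theorem exists_im_ne_zero_of_discrPoly_zeroA_pos {a b c d e : ℝ} (ha : a ≠ 0)
    (h : 0 < (discrPoly a b c d e).eval (zeroA a b)) :
    ∃ z : ℂ, z.im ≠ 0 ∧ ∃ t : ℝ, 0 ≤ t ∧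
      aeval z (coeffA a b) ^ 2 = -t * aeval z (discrPoly a b c d e) := by
  obtain ⟨p, hp⟩ : ∃ p, p = a ^ 2 + 4 * c := ⟨_, rfl⟩
  obtain ⟨q, hq⟩ : ∃ q, q = 2 * a * b + 4 * d := ⟨_, rfl⟩
  obtain ⟨r, hr⟩ : ∃ r, r = b ^ 2 + 4 * e := ⟨_, rfl⟩
  have hev : ∀ z : ℂ, aeval z (discrPoly a b c d e) = p * z ^ 2 + q * z + r := fun z => by
    rw [aeval_discrPoly, aeval_coeffA, hp, hq, hr]
    simp [coeffB]
    ring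
  have hk : 0 < p * b ^ 2 - q * a * b + r * a ^ 2 := by
    have h1 : (discrPoly a b c d e).eval (zeroA a b) * a ^ 2
        = p * b ^ 2 - q * a * b + r * a ^ 2 := by
      simp [discrPoly, coeffA, coeffB, zeroA, hp, hq, hr]
      field_simp
      ring
    rw [← h1]
    positivity
  -- `A ^ 2 + t * Δ` is a real quadratic with double root `x_A` at `t = 0`. To first order in `t`
  -- its discriminant is `-4 * t * a ^ 2 * Δ(x_A) < 0`, so small `t > 0` splits the root into a
  -- nonreal pair.
  have hlead : ∀ᶠ t : ℝ in 𝓝[>] 0, 0 < a ^ 2 + t * p := by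
    have hc : ContinuousAt (fun t : ℝ => a ^ 2 + t * p) 0 := by fun_prop
    exact nhdsWithin_le_nhds (hc.eventually_const_lt (by simp; positivity))
  have hdisc : ∀ᶠ t : ℝ in 𝓝[>] 0,
      0 < 4 * (p * b ^ 2 - q * a * b + r * a ^ 2) + t * (4 * p * r - q ^ 2) := by
    have hc : ContinuousAt (fun t : ℝ =>
      4 * (p * b ^ 2 - q * a * b + r * a ^ 2) + t * (4 * p * r - q ^ 2)) 0 := by fun_prop
    exact nhdsWithin_le_nhds (hc.eventually_const_lt (by simpa using hk))
  obtain ⟨t, ht1, ht2, ht0⟩ := (hlead.and (hdisc.and self_mem_nhdsWithin)).exists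
  have ht0' : 0 < t := ht0
  set α := a ^ 2 + t * p with hα
  set β := 2 * a * b + t * q with hβ
  set γ := b ^ 2 + t * r with hγ
  have hneg : 0 < 4 * α * γ - β ^ 2 := by
    have : 4 * α * γ - β ^ 2
        = t * (4 * (p * b ^ 2 - q * a * b + r * a ^ 2) + t * (4 * p * r - q ^ 2)) := by
      rw [hα, hβ, hγ]
      ring
    rw [this]
    positivity
  set y := Real.sqrt (4 * α * γ - β ^ 2) with hy
  have hy0 : 0 < y := Real.sqrt_pos.2 hneg
  have hy2 : (y : ℂ) ^ 2 = 4 * α * γ - β ^ 2 := by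
    have := Real.sq_sqrt hneg.le
    rw [← hy] at this
    exact_mod_cast this
  have hαC : (α : ℂ) ≠ 0 := by exact_mod_cast ht1.ne'
  refine ⟨(((-β / (2 * α) : ℝ) : ℂ) + ((y / (2 * α) : ℝ) : ℂ) * Complex.I), ?_, t, ht0'.le, ?_⟩
  · have him : ∀ u v : ℝ, ((u : ℂ) + v * Complex.I).im = v := by simp
    rw [him]
    positivity
  · set z : ℂ := ((-β / (2 * α) : ℝ) : ℂ) + ((y / (2 * α) : ℝ) : ℂ) * Complex.I with hz
    have hroot : (α : ℂ) * z ^ 2 + β * z + γ = 0 := by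
      have h1 : 2 * α * z + β = y * Complex.I := by
        rw [hz]
        push_cast
        field_simp
        ring
      have h2 : 4 * (α : ℂ) * (α * z ^ 2 + β * z + γ) = 0 := by
        linear_combination (2 * α * z + β + y * Complex.I) * h1 + (y : ℂ) ^ 2 * Complex.I_sq - hy2
      simpa [hαC] using h2
    rw [hev, aeval_coeffA]
    rw [hα, hβ, hγ] at hroot
    push_cast at hroot
    linear_combination hroot

/-- If the real polynomial `Δ`, of degree at most one, has positive leading coefficient, then
points of equal modulus occur outside the closed unit disk. -/
theorem exists_one_lt_norm_of_natDegree_discrPoly_le_one {a b c d e : ℝ}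
    (hdeg : (discrPoly a b c d e).natDegree ≤ 1) (ha : a ≠ 0)
    (hlc : 0 < (discrPoly a b c d e).leadingCoeff) :
    ∃ z : ℂ, 1 < ‖z‖ ∧ ∃ t : ℝ, 0 ≤ t ∧
      aeval z (coeffA a b) ^ 2 = -t * aeval z (discrPoly a b c d e) := by
  rcases Nat.le_one_iff_eq_zero_or_eq_one.1 hdeg with h0 | h1
  · obtain ⟨k, hk⟩ := natDegree_eq_zero.1 h0
    rw [← hk] at hlc ⊢
    have hk0 : 0 < k := by simpa using hlc
    have haC : (a : ℂ) ≠ 0 := by exact_mod_cast ha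
    have hkC : (k : ℂ) ≠ 0 := by exact_mod_cast hk0.ne'
    -- At `x_A + 2i`, `A ^ 2 = -4 * a ^ 2`, and the imaginary part already exceeds `1`.
    refine ⟨zeroA a b + 2 * Complex.I, ?_, 4 * a ^ 2 / k, by positivity, ?_⟩
    · refine lt_of_lt_of_le ?_ (Complex.abs_im_le_norm _)
      simp
    · rw [aeval_coeffA, zeroA, aeval_C]
      push_cast
      have : (a : ℂ) * (-b / a + 2 * Complex.I) + b = 2 * a * Complex.I := by
        field_simp
        ring
      rw [this, mul_pow, Complex.I_sq]
      simp
      field_simp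
      ring
  · have hlin : ∀ x, (discrPoly a b c d e).eval x
        = (discrPoly a b c d e).leadingCoeff * x + (discrPoly a b c d e).coeff 0 := fun x => by
      conv_lhs => rw [eq_X_add_C_of_natDegree_le_one hdeg]
      simp [leadingCoeff, h1]
    set l := (discrPoly a b c d e).leadingCoeff with hl
    set m := (discrPoly a b c d e).coeff 0 with hm
    -- Chosen so that `x ≤ -2` and `Δ(x) = -|m| - 2 * l + m < 0`.
    set x : ℝ := -(|m| / l + 2) with hx
    have hml : 0 ≤ |m| / l := by positivity
    have hneg : (discrPoly a b c d e).eval x < 0 := by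
      have h2 : l * x = -|m| - 2 * l := by
        rw [hx]
        field_simp
        ring
      rw [hlin, h2]
      linarith [le_abs_self m]
    refine ⟨x, ?_, exists_sq_eq_neg_mul_of_discrPoly_neg hneg⟩
    rw [Complex.norm_real, Real.norm_eq_abs, hx, abs_neg]
    exact lt_of_lt_of_le (by linarith) (le_abs_self _)

/-- If the real points with `Δ < 0` are bounded above, then `Δ` has positive leading
coefficient. -/
theorem discrPoly_leadingCoeff_pos {a b c d e M : ℝ} (h0 : discrPoly a b c d e ≠ 0)
    (h : ∀ x : ℝ, (discrPoly a b c d e).eval x < 0 → x ≤ M) :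
    0 < (discrPoly a b c d e).leadingCoeff := by
  by_contra hlc
  have hlt := lt_of_le_of_ne (not_lt.1 hlc) (leadingCoeff_ne_zero.2 h0)
  obtain ⟨x, hx, hxM⟩ :=
    ((eventually_eval_neg_of_leadingCoeff_neg hlt).and (eventually_gt_atTop M)).exists
  exact (h x hx).not_gt hxM

/-! ### The three necessary conditions -/

theorem mainTheorem4 (a b c d e : ℝ) (hac : a * c ≠ 0) (W : ℕ → ℂ[X])
    (hW : IsGeneralSeq a b c d e W) :
    (EventuallyHas IsRealRooted W →
      (discrPoly a b c d e).eval (zeroA a b) < 0 ∧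
      ((∃ k : ℝ, k < 0 ∧ discrPoly a b c d e = C k) ∨
        IsRealRooted (discrPoly a b c d e))) ∧
    (EventuallyHas IsHurwitz W →
      0 < (discrPoly a b c d e).leadingCoeff ∧
      IsHurwitz (coeffA a b * discrPoly a b c d e)) ∧
    (EventuallyHas IsSchurStable W →
      (discrPoly a b c d e).natDegree = 2 ∧
      0 < (discrPoly a b c d e).leadingCoeff ∧
      IsSchurStable (coeffA a b * discrPoly a b c d e)) := by
  have ha : a ≠ 0 := left_ne_zero_of_mul hac
  have hD0 := hW.discrPoly_ne_zero ha
  have hprod : ∀ {S : Set ℂ}, IsClosed S →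
      (∃ N : ℕ, 0 < N ∧ ∀ n, N < n → ∀ z : ℂ, aeval z (W n) = 0 → z ∈ S) →
      ∀ z : ℂ, aeval z (coeffA a b * discrPoly a b c d e) = 0 → z ∈ S := by
    intro S hS hev z hz
    rw [map_mul, mul_eq_zero] at hz
    refine hW.mem_of_isClosed ha hS hev ?_
    rcases hz with hz | hz
    -- A zero of `A` lies on the locus with `t = 0`.
    · exact Or.inr ⟨0, le_rfl, by simp [hz]⟩
    · exact Or.inl hz
  refine ⟨fun h => ?_, fun h => ?_, fun h => ?_⟩
  · have hS : IsClosed {z : ℂ | z.im = 0} := isClosed_eq Complex.continuous_im continuous_const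
    -- The second alternative always holds: a nonzero constant is vacuously real-rooted.
    refine ⟨?_, Or.inr fun z hz => hW.mem_of_isClosed ha hS h (Or.inl hz)⟩
    by_contra hneg
    have hne : (discrPoly a b c d e).eval (zeroA a b) ≠ 0 := fun h0 => by
      apply hW.aeval_discrPoly_zeroA_ne_zero ha
      rw [aeval_ofReal_eq, h0, Complex.ofReal_zero]
    obtain ⟨z, hz, ht⟩ := exists_im_ne_zero_of_discrPoly_zeroA_pos ha
      (lt_of_le_of_ne (not_lt.1 hneg) hne.symm)
    exact hz (hW.mem_of_isClosed ha hS h (Or.inr ht))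
  · have hS : IsClosed {z : ℂ | z.re ≤ 0} := isClosed_le Complex.continuous_re continuous_const
    refine ⟨discrPoly_leadingCoeff_pos (M := 0) hD0 fun x hx => ?_, hprod hS h⟩
    simpa using hW.mem_of_isClosed ha hS h (Or.inr (exists_sq_eq_neg_mul_of_discrPoly_neg hx))
  · have hS : IsClosed {z : ℂ | ‖z‖ ≤ 1} := isClosed_le continuous_norm continuous_const
    have hlc : 0 < (discrPoly a b c d e).leadingCoeff := by
      refine discrPoly_leadingCoeff_pos (M := 1) hD0 fun x hx => ?_
      have h1 : ‖(x : ℂ)‖ ≤ 1 :=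
        hW.mem_of_isClosed ha hS h (Or.inr (exists_sq_eq_neg_mul_of_discrPoly_neg hx))
      rw [Complex.norm_real, Real.norm_eq_abs] at h1
      exact (le_abs_self x).trans h1
    refine ⟨?_, hlc, hprod hS h⟩
    by_contra hdeg
    have h2 := natDegree_discrPoly_le a b c d e
    obtain ⟨z, hz, ht⟩ :=
      exists_one_lt_norm_of_natDegree_discrPoly_le_one (by omega) ha hlc
    exact hz.not_ge (hW.mem_of_isClosed ha hS h (Or.inr ht))
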